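/- Theorem (Regret bound for minimalist Thompson sampling). Let $K\ge 1$ be an integer and let $\mathcal P_1,\dots,\mathcal P_K$ be probability distributions on $\mathbb R$, the reward distributions of the arms of a $K$-armed bandit, with means $\mu_j=\mathbb E_{y\sim\mathcal P_j}[y]$. Assume that the rewards are $1$-sub-Gaussian: $$\mathbb E_{y\sim\mathcal P_j}\, e^{\lambda (y-\mu_j)}\le e^{\lambda^2/2}\qquad\text{for all }\lambda\in\mathbb R,\ j\in[K]=\{1,\dots,K\}.$$ Put $\Delta_j=\max_{k\in[K]}\mu_k-\mu_j$. Fix $\sigma>1$. For a dataset $\mathcal D_t=((x_i,\phi_i))_{i=1}^t$ with $x_i\in[K]$, $\phi_i\in\mathbb R$, define the Gaussian working likelihood of $\theta\in\mathbb R^K$ and the profile likelihood of arm $j$ by $$\mathcal L(\theta;\mathcal D_t)=\prod_{i=1}^t\frac1{\sqrt{2\pi}\,\sigma}\exp\Big(-\frac{(\theta_{x_i}-\phi_i)^2}{2\sigma^2}\Big),\qquad \bar{\mathcal L}(j;\mathcal D_t)=\sup\{\mathcal L(\theta;\mathcal D_t):\ \theta\in\mathbb R^K,\ \theta_j\ge\theta_k\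 \text{for all }k\in[K]\}.$$ With the uniform prior $\mathcal Q_0(j)=1/K$, the generalized posterior is $$\mathcal Q_t(j)=\frac{\bar{\mathcal L}(j;\mathcal D_t)\,\mathcal Q_0(j)}{\sum_{k=1}^K\bar{\mathcal L}(k;\mathcal D_t)\,\mathcal Q_0(k)},\qquad j\in[K].$$ Minimalist Thompson sampling (MINTS) starts from $\mathcal D_0=\varnothing$ and runs over the rounds $t=1,2,\dots$: conditionally on $\mathcal D_{t-1}$, draw $x_t$ from $\mathcal Q_{t-1}$; conditionally on $\mathcal D_{t-1}$ and $x_t$, the reward $\phi_t$ has law $\mathcal P_{x_t}$; then append $(x_t,\phi_t)$ to $\mathcal D_{t-1}$ to obtain $\mathcal D_t$. Let $\mathcal R(T)=\sum_{t=1}^T\big(\max_{j\in[K]}\mu_j-\mu_{x_t}\big)$ be the regret. Then there is a constant $C>0$, depending only on $\sigma$, such that for all $K$, all such $\mathcal P_1,\dots,\mathcal P_K$, and all integers $T\ge1$, $$\mathbb E[\mathcal R(T)]\le C\left(\min\Big\{\sum_{j:\,\Delta_j>0}\frac{\log T}{\Delta_j},\ \sqrt{KT\log K}\Big\}+\sum_{j=1}^K\Delta_j\right).$$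 -/

import Mathlib

open MeasureTheory ProbabilityTheory

noncomputable section

namespace MINTS

/-- A dataset of `t` decision-feedback pairs `(x_i, φ_i)` for a bandit with `K` arms. -/
abbrev Dataset (K t : ℕ) : Type := Fin t → Fin K × ℝ

/-- The Gaussian working likelihood of the mean vector `θ`, with known standard deviation `σ`. -/
def likelihood {K t : ℕ} (σ : ℝ) (θ : Fin K → ℝ) (D : Dataset K t) : ℝ :=
  ∏ i, 1 / (Real.sqrt (2 * Real.pi) * σ) *
    Real.exp (-((θ (D i).1 - (D i).2) ^ 2 / (2 * σ ^ 2)))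

/-- The mean vectors for which arm `j` is optimal. -/
def optimalAt {K : ℕ} (j : Fin K) : Set (Fin K → ℝ) := {v | ∀ k, v k ≤ v j}

/-- The profile likelihood of the hypothesis that arm `j` is optimal. -/
def profileLikelihood {K t : ℕ} (σ : ℝ) (j : Fin K) (D : Dataset K t) : ℝ :=
  ⨆ v : optimalAt j, likelihood σ (v : Fin K → ℝ) D

/-- The generalized posterior probability of arm `j`, for a prior with weights `Q₀`. -/
def posterior {K t : ℕ} (σ : ℝ) (Q₀ : Fin K → ℝ) (D : Dataset K t) (j : Fin K) : ℝ :=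
  profileLikelihood σ j D * Q₀ j / ∑ k, profileLikelihood σ k D * Q₀ k

/-- The weights of the uniform prior over the arms. -/
def uniformPrior (K : ℕ) : Fin K → ℝ := fun _ => 1 / (K : ℝ)

lemma likelihood_pos {K t : ℕ} {σ : ℝ} (hσ : 0 < σ) (θ : Fin K → ℝ) (D : Dataset K t) :
    0 < likelihood σ θ D :=
  Finset.prod_pos fun _ _ => by positivity

lemma abs_likelihood_le {K t : ℕ} (σ : ℝ) (θ : Fin K → ℝ) (D : Dataset K t) :
    |likelihood σ θ D| ≤ ∏ _i : Fin t, |1 / (Real.sqrt (2 * Real.pi) * σ)| := by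
  unfold likelihood
  rw [Finset.abs_prod]
  refine Finset.prod_le_prod (fun _ _ => abs_nonneg _) fun i _ => ?_
  rw [abs_mul, abs_of_pos (Real.exp_pos _)]
  refine mul_le_of_le_one_right (abs_nonneg _) (Real.exp_le_one_iff.2 ?_)
  have : 0 ≤ (θ (D i).1 - (D i).2) ^ 2 / (2 * σ ^ 2) := by positivity
  linarith

lemma bddAbove_likelihood {K t : ℕ} (σ : ℝ) (j : Fin K) (D : Dataset K t) :
    BddAbove (Set.range fun v : optimalAt j => likelihood σ (v : Fin K → ℝ) D) :=
  ⟨∏ _i : Fin t, |1 / (Real.sqrt (2 * Real.pi) * σ)|, by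
    rintro _ ⟨v, rfl⟩
    exact (le_abs_self _).trans (abs_likelihood_le σ (v : Fin K → ℝ) D)⟩

lemma continuous_likelihood {K t : ℕ} (σ : ℝ) (θ : Fin K → ℝ) :
    Continuous fun D : Dataset K t => likelihood σ θ D := by
  unfold likelihood
  have h (i : Fin t) : Continuous fun D : Dataset K t => θ (D i).1 :=
    (continuous_of_discreteTopology (f := θ)).comp (continuous_fst.comp (continuous_apply i))
  have h' (i : Fin t) : Continuous fun D : Dataset K t => (D i).2 :=
    continuous_snd.comp (continuous_apply i)
  exact continuous_finsetProd _ fun i _ => continuous_const.mul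
    (Real.continuous_exp.comp ((((h i).sub (h' i)).pow 2).div_const _).neg)

lemma measurable_profileLikelihood {K t : ℕ} (σ : ℝ) (j : Fin K) :
    Measurable fun D : Dataset K t => profileLikelihood σ j D := by
  have : LowerSemicontinuous fun D : Dataset K t => profileLikelihood σ j D :=
    lowerSemicontinuous_ciSup (bddAbove_likelihood σ j)
      fun v => (continuous_likelihood σ (v : Fin K → ℝ)).lowerSemicontinuous
  exact this.measurable

lemma measurable_posterior {K t : ℕ} (σ : ℝ) (Q₀ : Fin K → ℝ) (j : Fin K) :
    Measurable fun D : Dataset K t => posterior σ Q₀ D j := by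
  unfold posterior
  exact ((measurable_profileLikelihood σ j).mul_const _).div
    (Finset.measurable_sum _ fun k _ => (measurable_profileLikelihood σ k).mul_const _)

lemma profileLikelihood_pos {K t : ℕ} {σ : ℝ} (hσ : 0 < σ) (j : Fin K) (D : Dataset K t) :
    0 < profileLikelihood σ j D :=
  (likelihood_pos hσ 0 D).trans_le
    (le_ciSup (bddAbove_likelihood σ j D) ⟨0, fun _ => le_refl _⟩)

/-- The rule of the algorithm after `t` rounds: the law on the arms that gives arm `j` its
generalized posterior probability, as a function of the data. -/
def decisionKernel {K : ℕ} (σ : ℝ) (Q₀ : Fin K → ℝ) (t : ℕ) :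
    Kernel (Dataset K t) (Fin K) where
  toFun D := ∑ j, ENNReal.ofReal (posterior σ Q₀ D j) • Measure.dirac j
  measurable' := by
    refine Measure.measurable_of_measurable_coe _ fun s _ => ?_
    simp only [Measure.coe_finsetSum, Finset.sum_apply, Measure.smul_apply, smul_eq_mul]
    exact Finset.measurable_sum _ fun j _ =>
      (measurable_posterior σ Q₀ j).ennreal_ofReal.mul_const _

/-- For a genuine prior, the rule of the algorithm is a probability distribution on the arms. -/
lemma isMarkovKernel_decisionKernel {K : ℕ} {σ : ℝ} (hσ : 0 < σ) {Q₀ : Fin K → ℝ}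
    (h0 : ∀ j, 0 ≤ Q₀ j) (h1 : ∑ j, Q₀ j = 1) (t : ℕ) :
    IsMarkovKernel (decisionKernel σ Q₀ t) := by
  refine ⟨fun D => ⟨?_⟩⟩
  have hnn (k : Fin K) : 0 ≤ profileLikelihood σ k D * Q₀ k :=
    mul_nonneg (profileLikelihood_pos hσ k D).le (h0 k)
  have hpos : 0 < ∑ k, profileLikelihood σ k D * Q₀ k := by
    obtain ⟨k, -, hk⟩ := Finset.exists_ne_zero_of_sum_ne_zero (h1.trans_ne one_ne_zero)
    exact Finset.sum_pos' (fun k _ => hnn k) ⟨k, Finset.mem_univ k,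
      mul_pos (profileLikelihood_pos hσ k D) ((h0 k).lt_of_ne' hk)⟩
  change (∑ j, ENNReal.ofReal (posterior σ Q₀ D j) • Measure.dirac j : Measure (Fin K)) _ = 1
  simp only [Measure.coe_finsetSum, Finset.sum_apply, Measure.smul_apply, measure_univ,
    smul_eq_mul, mul_one]
  have hp (j : Fin K) : 0 ≤ posterior σ Q₀ D j := div_nonneg (hnn j) hpos.le
  rw [← ENNReal.ofReal_sum_of_nonneg fun j _ => hp j]
  simp only [posterior, ← Finset.sum_div]
  rw [div_self hpos.ne', ENNReal.ofReal_one]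

/-- The data collected in the first `t` rounds. The decision and the feedback of round `t + 1`
are `x t` and `φ t`. -/
def dataset {K : ℕ} {Ω : Type*} (x : ℕ → Ω → Fin K) (φ : ℕ → Ω → ℝ) (t : ℕ) (ω : Ω) :
    Dataset K t :=
  fun i => (x i ω, φ i ω)

/-- `x`, `φ` are the decisions and the rewards of a run, on the probability space `(Ω, Pr)`, of
minimalist Thompson sampling on the `K`-armed bandit with reward distributions `P`. -/
structure IsRun {K : ℕ} {Ω : Type*} [MeasurableSpace Ω] (Pr : Measure Ω) (σ : ℝ)
    (Q₀ : Fin K → ℝ) (P : Fin K → Measure ℝ) (x : ℕ → Ω → Fin K) (φ : ℕ → Ω → ℝ) : Prop where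
  /-- Given the past data, the decision is drawn from the generalized posterior. -/
  decision : ∀ t, HasCondDistrib (x t) (dataset x φ t) (decisionKernel σ Q₀ t) Pr
  /-- Given the past data and the decision, the reward is drawn from the law of the chosen arm. -/
  feedback : ∀ t, HasCondDistrib (φ t) (fun ω => (dataset x φ t ω, x t ω))
    (Kernel.prodMkLeft (Dataset K t) (Kernel.ofFunOfCountable P)) Pr

/-- The expected reward of arm `j`. -/
def mean {K : ℕ} (P : Fin K → Measure ℝ) (j : Fin K) : ℝ := ∫ y, y ∂P j

/-- The sub-optimality gap of arm `j`. -/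
def gap {K : ℕ} (P : Fin K → Measure ℝ) (j : Fin K) : ℝ := (⨆ k, mean P k) - mean P j

/-- The regret of the decisions `x 0, …, x (T - 1)` of the first `T` rounds. -/
def regret {K : ℕ} (P : Fin K → Measure ℝ) (x : ℕ → Fin K) (T : ℕ) : ℝ :=
  ∑ t ∈ Finset.range T, ((⨆ k, mean P k) - mean P (x t))

end MINTS

end

/-!
Write `N` for the number of pulls of an arm and `W` for the sum of its centred rewards. The working
likelihood of `θ` is a product over the arms of Gaussian factors
`exp (-N (θ k - W / N) ^ 2 / (2 σ²))`, with `θ k` measured from the true mean `μ k`.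

*The posterior.* Let `k` be a best arm and `j` an arm with gap `Δ > 0`. A vector `v` with maximal
coordinate `v j` has `v j` above or below the midpoint of `μ j` and `μ k`. If it is above, then `v`
misfits arm `j`, and moving `v j` to the empirical mean gains at least a factor `1 / discount`. If
it is below, then `v` misfits arm `k`, and raising `v k` to the larger of `v j` and the empirical
mean gives a vector for which `k` is optimal, and gains at least such a factor, too. Hence the
posterior weights satisfy `q j ≤ discount j + q k * discount k` (`posterior_le_discount_add`),
where `discount = exp (-Δ² N / (16 σ²)) * exp (W² / (2 σ² N))`.

*The noise.* For each `n` the expectation of `exp (W² / (2 σ² n))` at the `(n + 1)`-st pull of an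
arm is bounded by the moment `E exp (G² / (2 σ²))` of a standard Gaussian, finite because `σ > 1`
(`IsRun.sum_lintegral_exp_sq_le`). This follows from optional stopping of the supermartingales
`exp (l W - l² N / 2)` (`IsRun.sum_lintegral_expNoise_add_le_one`) by averaging over a Gaussian `l`.

*The number of pulls.* In the bound on `q j` the second term carries the weight `q k`, so that its
sum over the rounds is a sum over the pulls of arm `k`, and the expectation is at most a geometric
series, of order `1 + 1 / Δ²`. In the first term, the first `b` pulls of arm `j` are counted as
such. Later on, either the noise of arm `j` is so large that `q j ≤ q j * weight`, which again
sums over pulls to `O(1 + 1 / Δ²)`, or `discount j ≤ exp (-Δ² b / (32 σ²))`. With `b` of order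
`log⁺ (T Δ²) / Δ²` arm `j` costs `O(Δ + (1 + log⁺ (T Δ²)) / Δ)` in expectation
(`IsRun.gap_mul_expectedPulls_le`). Since `log⁺ (T Δ²)` and not `log T` appears, this
yields both bounds, the second one by treating gaps below `√(K log K / T)` trivially.
-/

noncomputable section

namespace MINTS

open scoped ENNReal

/-! ### Likelihood and profile likelihood -/

/-- The number of times that arm `k` occurs in the dataset. -/
def pulls {K t : ℕ} (D : Dataset K t) (k : Fin K) : ℕ := ∑ i, if (D i).1 = k then 1 else 0

/-- The sum of the rewards of arm `k` in the dataset, each centred at `m`. -/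
def noise {K t : ℕ} (m : ℝ) (D : Dataset K t) (k : Fin K) : ℝ :=
  ∑ i, if (D i).1 = k then (D i).2 - m else 0

lemma pulls_le {K t : ℕ} (D : Dataset K t) (k : Fin K) : pulls D k ≤ t := by
  have : pulls D k ≤ ∑ _i : Fin t, 1 :=
    Finset.sum_le_sum fun i _ => by split_ifs <;> simp
  simpa using this

lemma noise_eq_zero_of_pulls_eq_zero {K t : ℕ} {D : Dataset K t} {k : Fin K}
    (h : pulls D k = 0) (m : ℝ) : noise m D k = 0 := by
  refine Finset.sum_eq_zero fun i hi => if_neg fun hik => ?_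
  have := Finset.sum_eq_zero_iff.1 h i hi
  simp [hik] at this

/-- Moving the `k`-th coordinate of `θ` from `θ k` to `a` changes the likelihood by the factor
read off from the quadratic `n p² - 2 p W` in the displacement `p` from the centre `m`, where `n`
and `W` are the number and the centred sum of the rewards of arm `k`. -/
lemma likelihood_eq_update_mul_exp {K t : ℕ} (σ : ℝ) (θ : Fin K → ℝ) (D : Dataset K t)
    (k : Fin K) (a m : ℝ) :
    likelihood σ θ D = likelihood σ (Function.update θ k a) D *
      Real.exp (-((pulls D k * (θ k - m) ^ 2 - 2 * (θ k - m) * noise m D k) -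
        (pulls D k * (a - m) ^ 2 - 2 * (a - m) * noise m D k)) / (2 * σ ^ 2)) := by
  have key : -((pulls D k * (θ k - m) ^ 2 - 2 * (θ k - m) * noise m D k) -
        (pulls D k * (a - m) ^ 2 - 2 * (a - m) * noise m D k)) / (2 * σ ^ 2) =
      ∑ i, if (D i).1 = k then
        (-(θ k - (D i).2) ^ 2 + (a - (D i).2) ^ 2) / (2 * σ ^ 2) else 0 := by
    simp only [pulls, noise, Nat.cast_sum, Finset.sum_mul, Finset.mul_sum,
      ← Finset.sum_sub_distrib, ← Finset.sum_neg_distrib, Finset.sum_div]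
    refine Finset.sum_congr rfl fun i _ => ?_
    split_ifs <;> push_cast <;> ring
  rw [key, Real.exp_sum]
  unfold likelihood
  rw [← Finset.prod_mul_distrib]
  refine Finset.prod_congr rfl fun i _ => ?_
  by_cases hi : (D i).1 = k
  · rw [if_pos hi, hi, Function.update_self, mul_assoc, ← Real.exp_add]
    congr 2
    ring
  · rw [if_neg hi, Function.update_of_ne hi, Real.exp_zero, mul_one]

lemma profileLikelihood_nonneg {K t : ℕ} {σ : ℝ} (hσ : 0 < σ) (j : Fin K) (D : Dataset K t) :
    0 ≤ profileLikelihood σ j D := (profileLikelihood_pos hσ j D).le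

/-- Every mean vector has an optimal arm. -/
lemma likelihood_le_sum_profileLikelihood {K t : ℕ} {σ : ℝ} (hσ : 0 < σ) (j : Fin K)
    (θ : Fin K → ℝ) (D : Dataset K t) :
    likelihood σ θ D ≤ ∑ k, profileLikelihood σ k D := by
  obtain ⟨k, -, hk⟩ := Finset.exists_max_image Finset.univ θ ⟨j, Finset.mem_univ j⟩
  exact (le_ciSup (bddAbove_likelihood σ k D) ⟨θ, fun i => hk i (Finset.mem_univ i)⟩).trans
    (Finset.single_le_sum (f := fun k => profileLikelihood σ k D)
      (fun i _ => profileLikelihood_nonneg hσ i D) (Finset.mem_univ k))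

/-- Completing the square: `n p² - 2 p W` exceeds its minimum `-W² / n` by
`n (p - W / n)² ≥ n p² / 2 - W² / n`. -/
lemma quadratic_lower_bound {n W p d : ℝ} (hn : 0 < n) (hp : d ^ 2 ≤ p ^ 2) :
    n * d ^ 2 / 2 - W ^ 2 / n ≤ (n * p ^ 2 - 2 * p * W) + W ^ 2 / n := by
  have h1 : n * (p / 2 - W / n) ^ 2 = n * p ^ 2 / 4 - p * W + W ^ 2 / n := by
    field_simp
    ring
  have h2 : 0 ≤ n * (p / 2 - W / n) ^ 2 := by positivity
  have h3 : n * d ^ 2 ≤ n * p ^ 2 := mul_le_mul_of_nonneg_left hp hn.le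
  linarith

/-- A bound on the factor by which the likelihood of a mean vector that is off by `Δ / 2` at arm `k`
falls short of the best one, if `m` is the mean of the arm: exponential decay in the number of
pulls, spoilt by the noise. The division by `pulls D k` is harmless, as the noise vanishes if the
arm has not been pulled. -/
def discount {K t : ℕ} (σ Δ m : ℝ) (D : Dataset K t) (k : Fin K) : ℝ :=
  Real.exp (-(Δ ^ 2 / (16 * σ ^ 2)) * pulls D k) *
    Real.exp (noise m D k ^ 2 / (2 * σ ^ 2 * pulls D k))

lemma discount_eq {K t : ℕ} {σ : ℝ} (hσ : 0 < σ) (Δ m : ℝ) (D : Dataset K t) (k : Fin K) :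
    discount σ Δ m D k = Real.exp (-(pulls D k * (Δ / 2) ^ 2 / 2 -
      noise m D k ^ 2 / pulls D k) / (2 * σ ^ 2)) := by
  rw [discount, ← Real.exp_add]
  congr 1
  rcases (pulls D k).eq_zero_or_pos with h | h
  · simp [h]
  · have : (0 : ℝ) < pulls D k := by exact_mod_cast h
    field_simp
    ring

/-- If `v j` is at least `Δ / 2` above `m`, compare `v` with the vector in which `v j` is replaced
by the empirical mean of arm `j`. -/
lemma likelihood_le_discount_mul_sum {K t : ℕ} {σ : ℝ} (hσ : 0 < σ) {Δ m : ℝ} (hΔ : 0 ≤ Δ)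
    (v : Fin K → ℝ) (D : Dataset K t) (j : Fin K) (h : m + Δ / 2 ≤ v j) :
    likelihood σ v D ≤ discount σ Δ m D j * ∑ k, profileLikelihood σ k D := by
  rw [likelihood_eq_update_mul_exp σ v D j (m + noise m D j / pulls D j) m, discount_eq hσ,
    mul_comm]
  refine mul_le_mul (Real.exp_le_exp.2 ?_) (likelihood_le_sum_profileLikelihood hσ j _ D)
    (likelihood_pos hσ _ D).le (Real.exp_pos _).le
  refine div_le_div_of_nonneg_right (neg_le_neg ?_) (by positivity)
  rcases (pulls D j).eq_zero_or_pos with h0 | h0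
  · simp [h0, noise_eq_zero_of_pulls_eq_zero h0]
  · have hn : (0 : ℝ) < pulls D j := by exact_mod_cast h0
    have := quadratic_lower_bound (W := noise m D j) hn
      (show (Δ / 2) ^ 2 ≤ (v j - m) ^ 2 from by gcongr; linarith)
    refine this.trans_eq ?_
    field_simp
    ring

/-- If `j` is optimal for `v` with `v j` at least `Δ / 2` below `m`, raise the `k`-th coordinate of
`v` to the larger of `v j` and the empirical mean of arm `k`, which makes `k` optimal. -/
lemma likelihood_le_discount_mul_profileLikelihood {K t : ℕ} {σ : ℝ} (hσ : 0 < σ) {Δ m : ℝ}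
    (hΔ : 0 ≤ Δ) {v : Fin K → ℝ} {j : Fin K} (hv : v ∈ optimalAt j) (D : Dataset K t)
    (k : Fin K) (h : v j ≤ m - Δ / 2) :
    likelihood σ v D ≤ discount σ Δ m D k * profileLikelihood σ k D := by
  have hv' : ∀ i, v i ≤ v j := hv
  set n : ℝ := (pulls D k : ℝ) with hn_def
  set W := noise m D k with hW_def
  set a := max (v j) (m + W / n) with ha
  have hopt : Function.update v k a ∈ optimalAt k := by
    intro i
    rw [Function.update_self]
    rcases eq_or_ne i k with rfl | hik
    · rw [Function.update_self]
    · rw [Function.update_of_ne hik]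
      exact (hv' i).trans (le_max_left _ _)
  rw [likelihood_eq_update_mul_exp σ v D k a m, discount_eq hσ, mul_comm]
  refine mul_le_mul (Real.exp_le_exp.2 ?_)
    (le_ciSup (bddAbove_likelihood σ k D) ⟨_, hopt⟩)
    (likelihood_pos hσ _ D).le (Real.exp_pos _).le
  rw [← hn_def, ← hW_def]
  refine div_le_div_of_nonneg_right (neg_le_neg ?_) (by positivity)
  rcases (pulls D k).eq_zero_or_pos with h0 | h0
  · simp [hn_def, hW_def, h0, noise_eq_zero_of_pulls_eq_zero h0]
  have hn : 0 < n := by rw [hn_def]; exact_mod_cast h0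
  have hk := hv' k
  rcases le_total (v j) (m + W / n) with hle | hle
  · rw [max_eq_right hle] at ha
    have := quadratic_lower_bound (W := W) hn
      (show (Δ / 2) ^ 2 ≤ (v k - m) ^ 2 from sq_le_sq' (by linarith) (by linarith) |>.trans_eq
        (by ring : (m - v k) ^ 2 = _))
    refine this.trans_eq ?_
    rw [ha]
    field_simp
    ring
  · rw [max_eq_left hle] at ha
    -- With `p = v k - m ≤ q = v j - m ≤ -Δ / 2` and `w = W / n ≤ q`, the claim divided by `n` is
    -- `Δ ^ 2 / 8 - w ^ 2 ≤ (p - w) ^ 2 - (q - w) ^ 2`.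
    obtain ⟨w, hw⟩ : ∃ w, w = W / n := ⟨_, rfl⟩
    have hWw : W = n * w := by rw [hw]; field_simp
    have h1 : W ^ 2 / n = n * w ^ 2 := by rw [hWw]; field_simp
    rw [h1, hWw, ha]
    rw [← hw] at hle
    obtain ⟨q, hq⟩ : ∃ q, q = v j - m := ⟨_, rfl⟩
    have hwq : w ≤ q := by linarith
    have hqΔ : q ≤ -(Δ / 2) := by linarith
    have h2 : (Δ / 2) ^ 2 / 2 - w ^ 2 ≤ -(q - w) ^ 2 := by
      nlinarith [mul_nonneg_of_nonpos_of_nonpos (by linarith : q ≤ 0) (sub_nonpos.2 hwq),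
        mul_nonneg (by linarith : 0 ≤ -q - Δ / 2) (by linarith : 0 ≤ -q + Δ / 2)]
    have h3 := mul_le_mul_of_nonneg_left h2 hn.le
    rw [← hq]
    nlinarith [mul_nonneg hn.le (sq_nonneg (v k - m - w))]

/-! ### The posterior -/

lemma posterior_uniformPrior {K t : ℕ} (σ : ℝ) (D : Dataset K t) (j : Fin K) :
    posterior σ (uniformPrior K) D j =
      profileLikelihood σ j D / ∑ k, profileLikelihood σ k D := by
  have hK : (0 : ℝ) < K := by exact_mod_cast j.pos
  unfold posterior uniformPrior
  rw [← Finset.sum_mul, mul_div_mul_right _ _ (by positivity)]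

lemma sum_profileLikelihood_pos {K t : ℕ} {σ : ℝ} (hσ : 0 < σ) (j : Fin K) (D : Dataset K t) :
    0 < ∑ k, profileLikelihood σ k D :=
  Finset.sum_pos (fun k _ => profileLikelihood_pos hσ k D) ⟨j, Finset.mem_univ j⟩

lemma posterior_uniformPrior_nonneg {K t : ℕ} {σ : ℝ} (hσ : 0 < σ) (D : Dataset K t)
    (j : Fin K) : 0 ≤ posterior σ (uniformPrior K) D j := by
  rw [posterior_uniformPrior]
  exact div_nonneg (profileLikelihood_nonneg hσ j D) (sum_profileLikelihood_pos hσ j D).le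

/-- A mean vector for which `j` is optimal puts arm `j` above, or all arms below, the midpoint
between `m` and `m + Δ`. In the first case it misfits arm `j`, if the mean of arm `j` is `m`; in
the second it misfits arm `k`, if the mean of arm `k` is `m + Δ`, and is then compared with a
vector for which `k` is optimal. -/
lemma posterior_le_discount_add {K t : ℕ} {σ : ℝ} (hσ : 0 < σ) {Δ m : ℝ} (hΔ : 0 ≤ Δ)
    (D : Dataset K t) (j k : Fin K) :
    posterior σ (uniformPrior K) D j ≤ discount σ Δ m D j +
      posterior σ (uniformPrior K) D k * discount σ Δ (m + Δ) D k := by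
  have hS := sum_profileLikelihood_pos hσ j D
  have hd1 : 0 ≤ discount σ Δ m D j := by unfold discount; positivity
  have hd2 : 0 ≤ discount σ Δ (m + Δ) D k := by unfold discount; positivity
  have hk := profileLikelihood_nonneg hσ k D
  rw [posterior_uniformPrior, posterior_uniformPrior, div_mul_eq_mul_div,
    div_le_iff₀ hS, add_mul, div_mul_cancel₀ _ hS.ne']
  have : Nonempty (optimalAt j) := ⟨0, fun _ => le_rfl⟩
  refine ciSup_le fun ⟨v, hv⟩ => ?_
  rcases le_total (m + Δ / 2) (v j) with h | h
  · have := likelihood_le_discount_mul_sum hσ hΔ v D j h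
    have := mul_nonneg hk hd2
    linarith
  · have := likelihood_le_discount_mul_profileLikelihood hσ (m := m + Δ) hΔ hv D k (by linarith)
    have := mul_nonneg hd1 hS.le
    linarith

/-- `discount` with a free decay rate `c`. At half the rate of `discount` its expectation, summed
over the pulls of the arm, is bounded, and the other half is left to beat the noise. -/
def weight {K t : ℕ} (σ c m : ℝ) (D : Dataset K t) (k : Fin K) : ℝ :=
  Real.exp (-c * pulls D k) * Real.exp (noise m D k ^ 2 / (2 * σ ^ 2 * pulls D k))

lemma weight_nonneg {K t : ℕ} (σ c m : ℝ) (D : Dataset K t) (k : Fin K) :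
    0 ≤ weight σ c m D k := by unfold weight; positivity

/-- After more than `b` pulls of arm `j`, either its rewards deviate so much that `weight` is at
least one, or `discount` is at most `exp (-c b)`. -/
lemma posterior_le_of_pulls {K t : ℕ} {σ : ℝ} (hσ : 0 < σ) {Δ m c : ℝ} (hΔ : 0 ≤ Δ)
    (hc : c = Δ ^ 2 / (32 * σ ^ 2)) (b : ℝ) (D : Dataset K t) (j k : Fin K) :
    posterior σ (uniformPrior K) D j ≤
      posterior σ (uniformPrior K) D j * (if (pulls D j : ℝ) ≤ b then 1 else 0) +
      posterior σ (uniformPrior K) D j * weight σ c m D j + Real.exp (-c * b) +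
      posterior σ (uniformPrior K) D k * weight σ c (m + Δ) D k := by
  have hc0 : 0 ≤ c := by rw [hc]; positivity
  have hpj := posterior_uniformPrior_nonneg hσ D j
  have hpk := posterior_uniformPrior_nonneg hσ D k
  have hwj := mul_nonneg hpj (weight_nonneg σ c m D j)
  have hwk := mul_nonneg hpk (weight_nonneg σ c (m + Δ) D k)
  have he := Real.exp_pos (-c * b)
  have h2c : Δ ^ 2 / (16 * σ ^ 2) = 2 * c := by rw [hc]; ring
  split_ifs with hb
  · linarith
  have hb' : -c * pulls D j ≤ -c * b := by nlinarith
  rcases le_total (c * pulls D j) (noise m D j ^ 2 / (2 * σ ^ 2 * pulls D j)) with h | h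
  · have h1 : 1 ≤ weight σ c m D j := by
      rw [weight, ← Real.exp_add]
      exact Real.one_le_exp (by linarith)
    nlinarith
  · have h1 : discount σ Δ m D j ≤ Real.exp (-c * b) := by
      rw [discount, ← Real.exp_add, h2c]
      exact Real.exp_le_exp.2 (by linarith)
    have h2 : discount σ Δ (m + Δ) D k ≤ weight σ c (m + Δ) D k := by
      unfold discount weight
      rw [h2c]
      have : 0 ≤ c * pulls D k := by positivity
      gcongr
      linarith
    have := posterior_le_discount_add hσ (m := m) hΔ D j k
    have := mul_le_mul_of_nonneg_left h2 hpk
    linarith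

/-! ### Conditional laws along a run and optional stopping -/

@[fun_prop]
lemma measurable_pulls {K t : ℕ} (k : Fin K) :
    Measurable fun D : Dataset K t => pulls D k := by
  unfold pulls
  refine Finset.measurable_sum _ fun i _ => Measurable.ite ?_ measurable_const measurable_const
  exact (measurable_fst.comp (measurable_pi_apply i)) (measurableSet_singleton k)

@[fun_prop]
lemma measurable_noise {K t : ℕ} (m : ℝ) (k : Fin K) :
    Measurable fun D : Dataset K t => noise m D k := by
  unfold noise
  refine Finset.measurable_sum _ fun i _ => Measurable.ite ?_ ?_ measurable_const
  · exact (measurable_fst.comp (measurable_pi_apply i)) (measurableSet_singleton k)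
  · exact (measurable_snd.comp (measurable_pi_apply i)).sub_const m

lemma pulls_dataset_succ {K : ℕ} {Ω : Type*} (x : ℕ → Ω → Fin K) (φ : ℕ → Ω → ℝ) (t : ℕ)
    (ω : Ω) (k : Fin K) :
    pulls (dataset x φ (t + 1) ω) k =
      pulls (dataset x φ t ω) k + if x t ω = k then 1 else 0 := by
  simp [pulls, dataset, Fin.sum_univ_castSucc]
  rfl

lemma noise_dataset_succ {K : ℕ} {Ω : Type*} (x : ℕ → Ω → Fin K) (φ : ℕ → Ω → ℝ) (t : ℕ)
    (ω : Ω) (m : ℝ) (k : Fin K) :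
    noise m (dataset x φ (t + 1) ω) k =
      noise m (dataset x φ t ω) k + if x t ω = k then φ t ω - m else 0 := by
  simp [noise, dataset, Fin.sum_univ_castSucc]
  rfl

/-- The normalised exponential of the noise of arm `k`, a supermartingale along the run. -/
def expNoise {K t : ℕ} (l m : ℝ) (D : Dataset K t) (k : Fin K) : ℝ≥0∞ :=
  ENNReal.ofReal (Real.exp (l * noise m D k - l ^ 2 / 2 * pulls D k))

@[fun_prop]
lemma measurable_expNoise {K t : ℕ} (l m : ℝ) (k : Fin K) :
    Measurable fun D : Dataset K t => expNoise l m D k := by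
  unfold expNoise
  fun_prop

lemma expNoise_dataset_succ {K : ℕ} {Ω : Type*} (x : ℕ → Ω → Fin K) (φ : ℕ → Ω → ℝ)
    (l m : ℝ) (t : ℕ) (ω : Ω) (k : Fin K) :
    expNoise l m (dataset x φ (t + 1) ω) k = expNoise l m (dataset x φ t ω) k *
      if x t ω = k then ENNReal.ofReal (Real.exp (l * (φ t ω - m) - l ^ 2 / 2)) else 1 := by
  unfold expNoise
  rw [noise_dataset_succ, pulls_dataset_succ]
  split_ifs
  · rw [← ENNReal.ofReal_mul (Real.exp_pos _).le, ← Real.exp_add]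
    congr 2
    push_cast
    ring
  · simp

section Run

variable {K : ℕ} {Ω : Type*} [MeasurableSpace Ω] {Pr : Measure Ω}
  {σ : ℝ} {P : Fin K → Measure ℝ} {x : ℕ → Ω → Fin K} {φ : ℕ → Ω → ℝ}

lemma IsRun.aemeasurable_dataset {Q₀ : Fin K → ℝ} (h : IsRun Pr σ Q₀ P x φ) (t : ℕ) :
    AEMeasurable (dataset x φ t) Pr := (h.decision t).aemeasurable_fst

lemma IsRun.aemeasurable_decision {Q₀ : Fin K → ℝ} (h : IsRun Pr σ Q₀ P x φ) (t : ℕ) :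
    AEMeasurable (x t) Pr := (h.decision t).aemeasurable_snd

lemma IsRun.aemeasurable_ite {Q₀ : Fin K → ℝ} (h : IsRun Pr σ Q₀ P x φ) (t : ℕ) (k : Fin K)
    {f : Dataset K t → ℝ≥0∞} (hf : Measurable f) :
    AEMeasurable (fun ω => (if x t ω = k then 1 else 0) * f (dataset x φ t ω)) Pr :=
  ((measurable_of_countable fun a : Fin K => if a = k then (1 : ℝ≥0∞) else 0).comp_aemeasurable
    (h.aemeasurable_decision t)).mul (hf.comp_aemeasurable (h.aemeasurable_dataset t))

variable [IsProbabilityMeasure Pr]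

/-- An expectation over the arm drawn in round `t + 1` is an expectation over the posterior. -/
lemma IsRun.lintegral_decision (hσ : 0 < σ) (h : IsRun Pr σ (uniformPrior K) P x φ) (t : ℕ)
    (k : Fin K) {f : Dataset K t → ℝ≥0∞} (hf : Measurable f) :
    ∫⁻ ω, (if x t ω = k then 1 else 0) * f (dataset x φ t ω) ∂Pr =
      ∫⁻ ω, ENNReal.ofReal (posterior σ (uniformPrior K) (dataset x φ t ω) k) *
        f (dataset x φ t ω) ∂Pr := by
  have hK : (K : ℝ) ≠ 0 := by exact_mod_cast k.pos.ne'
  have := isMarkovKernel_decisionKernel hσ (Q₀ := uniformPrior K)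
    (fun _ => by unfold uniformPrior; positivity) (by simp [uniformPrior, hK]) t
  have hF : Measurable fun p : Dataset K t × Fin K => (if p.2 = k then 1 else 0) * f p.1 :=
    (Measurable.ite (measurable_snd (measurableSet_singleton k)) measurable_const
      measurable_const).mul (hf.comp measurable_fst)
  have hG : Measurable fun D : Dataset K t =>
      ENNReal.ofReal (posterior σ (uniformPrior K) D k) * f D :=
    (measurable_posterior σ _ k).ennreal_ofReal.mul hf
  rw [← lintegral_map' (μ := Pr) (f := fun p : Dataset K t × Fin K =>
      (if p.2 = k then 1 else 0) * f p.1) (g := fun ω => (dataset x φ t ω, x t ω))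
      hF.aemeasurable (h.decision t).aemeasurable, (h.decision t).map_eq,
    Measure.lintegral_compProd hF,
    ← lintegral_map' hG.aemeasurable (h.aemeasurable_dataset t)]
  refine lintegral_congr fun D => ?_
  change ∫⁻ a, _ ∂(∑ j, ENNReal.ofReal (posterior σ (uniformPrior K) D j) • Measure.dirac j) = _
  rw [lintegral_finsetSum_measure]
  simp

/-- Given that arm `k` is pulled, its reward is independent of the past and has law `P k`. -/
lemma IsRun.lintegral_feedback (hP : ∀ j, IsProbabilityMeasure (P j)) {Q₀ : Fin K → ℝ}
    (h : IsRun Pr σ Q₀ P x φ) (t : ℕ) (k : Fin K) {f : Dataset K t → ℝ≥0∞} (hf : Measurable f)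
    {g : ℝ → ℝ≥0∞} (hg : Measurable g) :
    ∫⁻ ω, (if x t ω = k then 1 else 0) * f (dataset x φ t ω) * g (φ t ω) ∂Pr =
      (∫⁻ ω, (if x t ω = k then 1 else 0) * f (dataset x φ t ω) ∂Pr) * ∫⁻ y, g y ∂P k := by
  have : IsMarkovKernel (Kernel.ofFunOfCountable P) := ⟨hP⟩
  have hF : Measurable fun p : Dataset K t × Fin K => (if p.2 = k then 1 else 0) * f p.1 :=
    (Measurable.ite (measurable_snd (measurableSet_singleton k)) measurable_const
      measurable_const).mul (hf.comp measurable_fst)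
  have hH : Measurable fun q : (Dataset K t × Fin K) × ℝ =>
      (if q.1.2 = k then 1 else 0) * f q.1.1 * g q.2 :=
    (hF.comp measurable_fst).mul (hg.comp measurable_snd)
  rw [← lintegral_map' (μ := Pr) (f := fun q : (Dataset K t × Fin K) × ℝ =>
      (if q.1.2 = k then 1 else 0) * f q.1.1 * g q.2)
      (g := fun ω => ((dataset x φ t ω, x t ω), φ t ω))
      hH.aemeasurable (h.feedback t).aemeasurable, (h.feedback t).map_eq,
    Measure.lintegral_compProd hH,
    ← lintegral_map' (μ := Pr) (f := fun p : Dataset K t × Fin K =>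
      (if p.2 = k then 1 else 0) * f p.1) hF.aemeasurable (h.feedback t).aemeasurable_fst,
    ← lintegral_mul_const _ hF]
  refine lintegral_congr fun p => ?_
  by_cases hp : p.2 = k
  · simp [hp, Kernel.prodMkLeft_apply, Kernel.ofFunOfCountable, lintegral_const_mul _ hg]
  · simp [hp]

/-- Optional stopping at the time of the pull of arm `k` that follows its first `n` pulls. The
second term is the part of the supermartingale that is not yet stopped. -/
lemma IsRun.sum_lintegral_expNoise_add_le_one (hP : ∀ j, IsProbabilityMeasure (P j))
    {Q₀ : Fin K → ℝ} (h : IsRun Pr σ Q₀ P x φ) {k : Fin K} {m : ℝ}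
    (hm : HasSubgaussianMGF (fun y : ℝ => y - m) 1 (P k)) (l : ℝ) (n T : ℕ) :
    ∑ t ∈ Finset.range T, ∫⁻ ω, (if x t ω = k then 1 else 0) *
        ((if pulls (dataset x φ t ω) k = n then 1 else 0) *
          expNoise l m (dataset x φ t ω) k) ∂Pr +
      ∫⁻ ω, (if pulls (dataset x φ T ω) k ≤ n then 1 else 0) *
        expNoise l m (dataset x φ T ω) k ∂Pr ≤ 1 := by
  induction T with
  | zero => simp [pulls, noise, expNoise]
  | succ T ih =>
    refine le_trans ?_ ih
    rw [Finset.sum_range_succ, add_assoc]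
    gcongr
    set g : ℝ → ℝ≥0∞ := fun y => ENNReal.ofReal (Real.exp (l * (y - m) - l ^ 2 / 2)) with hg_def
    have hg : Measurable g := by fun_prop
    have hg1 : ∫⁻ y, g y ∂P k ≤ 1 := by
      have hint := hm.integrable_exp_mul l
      have hmgf := hm.mgf_le l
      simp only [hg_def, sub_eq_add_neg _ (l ^ 2 / 2), Real.exp_add]
      rw [← ofReal_integral_eq_lintegral_ofReal (hint.mul_const _)
        (ae_of_all _ fun _ => by positivity), integral_mul_const, ENNReal.ofReal_le_one]
      calc mgf (fun y => y - m) (P k) l * Real.exp (-(l ^ 2 / 2))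
          ≤ Real.exp ((1 : NNReal) * l ^ 2 / 2) * Real.exp (-(l ^ 2 / 2)) := by gcongr
        _ = 1 := by rw [← Real.exp_add]; simp
    set f : Dataset K T → ℝ≥0∞ := fun D =>
      (if pulls D k < n then 1 else 0) * expNoise l m D k with hf_def
    have hf : Measurable f :=
      (Measurable.ite (measurable_pulls k measurableSet_Iio) measurable_const
        measurable_const).mul (measurable_expNoise l m k)
    set f₀ : Dataset K T → ℝ≥0∞ := fun D =>
      (if pulls D k = n then 1 else 0) * expNoise l m D k with hf₀_def
    have hf₀ : Measurable f₀ :=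
      (Measurable.ite (measurable_pulls k (measurableSet_singleton n)) measurable_const
        measurable_const).mul (measurable_expNoise l m k)
    set u : Ω → ℝ≥0∞ := fun ω => (if x T ω = k then 0 else 1) *
      ((if pulls (dataset x φ T ω) k ≤ n then 1 else 0) * expNoise l m (dataset x φ T ω) k)
    have hstep : ∫⁻ ω, (if pulls (dataset x φ (T + 1) ω) k ≤ n then 1 else 0) *
          expNoise l m (dataset x φ (T + 1) ω) k ∂Pr ≤
        (∫⁻ ω, (if x T ω = k then 1 else 0) * f (dataset x φ T ω) ∂Pr) + ∫⁻ ω, u ω ∂Pr := by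
      calc _ = ∫⁻ ω, ((if x T ω = k then 1 else 0) * f (dataset x φ T ω) * g (φ T ω) + u ω)
            ∂Pr := by
            refine lintegral_congr fun ω => ?_
            rw [expNoise_dataset_succ, pulls_dataset_succ]
            by_cases hx : x T ω = k
            · simp only [hx, if_true, hf_def, u, Nat.succ_le_iff, one_mul, zero_mul, add_zero,
                mul_assoc]
              rfl
            · simp [hx, u]
        _ = (∫⁻ ω, (if x T ω = k then 1 else 0) * f (dataset x φ T ω) ∂Pr) * ∫⁻ y, g y ∂P k +
            ∫⁻ ω, u ω ∂Pr := by
            have hfg : AEMeasurable (fun ω => (if x T ω = k then 1 else 0) *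
                f (dataset x φ T ω) * g (φ T ω)) Pr :=
              (h.aemeasurable_ite T k hf).mul
                (hg.comp_aemeasurable (h.feedback T).aemeasurable_snd)
            rw [lintegral_add_left' hfg, h.lintegral_feedback hP T k hf hg]
        _ ≤ _ := by
            gcongr
            exact mul_le_of_le_one_right' hg1
    calc _ ≤ ∫⁻ ω, (if x T ω = k then 1 else 0) * f₀ (dataset x φ T ω) ∂Pr +
          ((∫⁻ ω, (if x T ω = k then 1 else 0) * f (dataset x φ T ω) ∂Pr) + ∫⁻ ω, u ω ∂Pr) := by
            gcongr
      _ = ∫⁻ ω, ((if x T ω = k then 1 else 0) * f₀ (dataset x φ T ω) +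
          ((if x T ω = k then 1 else 0) * f (dataset x φ T ω) + u ω)) ∂Pr := by
            rw [lintegral_add_left' (h.aemeasurable_ite T k hf₀),
              lintegral_add_left' (h.aemeasurable_ite T k hf)]
      _ ≤ _ := by
            refine lintegral_mono fun ω => ?_
            by_cases hx : x T ω = k
            · simp only [hx, if_true, hf_def, hf₀_def, u, one_mul, zero_mul, add_zero, ← add_mul]
              gcongr
              split_ifs <;> first | omega | simp
            · simp [hx, u]

lemma IsRun.sum_lintegral_expNoise_le_one (hP : ∀ j, IsProbabilityMeasure (P j))
    {Q₀ : Fin K → ℝ} (h : IsRun Pr σ Q₀ P x φ) {k : Fin K} {m : ℝ}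
    (hm : HasSubgaussianMGF (fun y : ℝ => y - m) 1 (P k)) (l : ℝ) (n T : ℕ) :
    ∑ t ∈ Finset.range T, ∫⁻ ω, (if x t ω = k then 1 else 0) *
        ((if pulls (dataset x φ t ω) k = n then 1 else 0) *
          expNoise l m (dataset x φ t ω) k) ∂Pr ≤ 1 :=
  le_self_add.trans (h.sum_lintegral_expNoise_add_le_one hP hm l n T)

end Run

/-! ### Gaussian mixtures -/

/-- The moment `E exp (G ^ 2 / (2 σ ^ 2))` of a standard Gaussian `G`. -/
def gaussMoment (σ : ℝ) : ℝ≥0∞ :=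
  ∫⁻ g, ENNReal.ofReal (Real.exp (g ^ 2 / (2 * σ ^ 2))) ∂gaussianReal 0 1

lemma gaussMoment_lt_top {σ : ℝ} (hσ : 1 < σ) : gaussMoment σ < ∞ := by
  unfold gaussMoment
  rw [gaussianReal_of_var_ne_zero _ one_ne_zero,
    lintegral_withDensity_eq_lintegral_mul _ (measurable_gaussianPDF 0 1) (by fun_prop)]
  have hb : 0 < (1 - 1 / σ ^ 2) / 2 := by
    have : 1 / σ ^ 2 < 1 := by
      rw [div_lt_one (by positivity)]
      nlinarith
    linarith
  have hint := (integrable_exp_neg_mul_sq hb).const_mul (√(2 * Real.pi))⁻¹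
  refine lt_of_eq_of_lt (lintegral_congr fun g => ?_) hint.lintegral_lt_top
  rw [Pi.mul_apply, gaussianPDF, ← ENNReal.ofReal_mul (gaussianPDFReal_nonneg _ _ _),
    gaussianPDFReal, mul_assoc, ← Real.exp_add]
  have hσ0 : σ ≠ 0 := by positivity
  congr 3
  · simp
  · push_cast
    field_simp
    ring

/-- The Gaussian mixture over `l` of `exp (l w)` that produces `exp (w ^ 2 / (2 σ ^ 2 n))`. Both
sides are one for `n = 0`. -/
lemma ofReal_exp_sq_div_eq_lintegral (σ w : ℝ) (n : ℕ) :
    ENNReal.ofReal (Real.exp (w ^ 2 / (2 * σ ^ 2 * n))) =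
      ∫⁻ g, ENNReal.ofReal (Real.exp (g / (σ * √n) * w)) ∂gaussianReal 0 1 := by
  have h1 : (fun g : ℝ => Real.exp (g / (σ * √n) * w)) =
      fun g => Real.exp (w / (σ * √n) * g) := by
    ext g
    congr 1
    ring
  have h2 := congrFun (mgf_fun_id_gaussianReal (μ := 0) (v := 1)) (w / (σ * √n))
  rw [mgf, ← h1] at h2
  rw [← ofReal_integral_eq_lintegral_ofReal ?_ (ae_of_all _ fun _ => by positivity), h2]
  · congr 2
    rw [div_pow, mul_pow, Real.sq_sqrt (Nat.cast_nonneg n)]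
    push_cast
    rw [mul_assoc 2, ← div_div, ← div_div, ← div_div]
    ring
  · rw [h1]
    exact integrable_exp_mul_gaussianReal _

section Run

variable {K : ℕ} {Ω : Type*} [MeasurableSpace Ω] {Pr : Measure Ω} [IsProbabilityMeasure Pr]
  {σ : ℝ} {P : Fin K → Measure ℝ} {x : ℕ → Ω → Fin K} {φ : ℕ → Ω → ℝ}

/-- The mean of `exp (W ^ 2 / (2 σ ^ 2 n))` at the pull of arm `k` that follows its first `n` pulls,
where `W` is the noise of these: average `IsRun.sum_lintegral_expNoise_le_one` over a Gaussian
`l`. -/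
lemma IsRun.sum_lintegral_exp_sq_le (hP : ∀ j, IsProbabilityMeasure (P j))
    {Q₀ : Fin K → ℝ} (h : IsRun Pr σ Q₀ P x φ) {k : Fin K} {m : ℝ}
    (hm : HasSubgaussianMGF (fun y : ℝ => y - m) 1 (P k)) (n T : ℕ) :
    ∑ t ∈ Finset.range T, ∫⁻ ω, (if x t ω = k then 1 else 0) *
        ((if pulls (dataset x φ t ω) k = n then 1 else 0) *
          ENNReal.ofReal (Real.exp (noise m (dataset x φ t ω) k ^ 2 / (2 * σ ^ 2 * n)))) ∂Pr ≤
      gaussMoment σ := by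
  set l : ℝ → ℝ := fun g => g / (σ * √n) with hl
  have hlm : Measurable l := by fun_prop
  -- On the event `pulls = n` the normalising factor of `expNoise` is deterministic.
  have hexp (t : ℕ) (ω : Ω) (g : ℝ) : (if x t ω = k then 1 else 0) *
        ((if pulls (dataset x φ t ω) k = n then 1 else 0) *
          ENNReal.ofReal (Real.exp (l g * noise m (dataset x φ t ω) k))) =
      ENNReal.ofReal (Real.exp (l g ^ 2 / 2 * n)) * ((if x t ω = k then 1 else 0) *
        ((if pulls (dataset x φ t ω) k = n then 1 else 0) *
          expNoise (l g) m (dataset x φ t ω) k)) := by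
    by_cases hn : pulls (dataset x φ t ω) k = n
    · simp only [hn, if_true, one_mul, expNoise]
      rw [mul_left_comm, ← ENNReal.ofReal_mul (Real.exp_pos _).le, ← Real.exp_add]
      congr 3
      ring
    · simp [hn]
  have hmeas (t : ℕ) : Measurable fun q : (Dataset K t × Fin K) × ℝ =>
      (if q.1.2 = k then (1 : ℝ≥0∞) else 0) * ((if pulls q.1.1 k = n then 1 else 0) *
          ENNReal.ofReal (Real.exp (l q.2 * noise m q.1.1 k))) := by
    refine (Measurable.ite ((measurable_snd.comp measurable_fst) (measurableSet_singleton k))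
      measurable_const measurable_const).mul ((Measurable.ite ?_ measurable_const
      measurable_const).mul ?_)
    · exact ((measurable_pulls k).comp (measurable_fst.comp measurable_fst))
        (measurableSet_singleton n)
    · have h1 : Measurable fun q : (Dataset K t × Fin K) × ℝ => noise m q.1.1 k :=
        (measurable_noise m k).comp (measurable_fst.comp measurable_fst)
      have h2 : Measurable fun q : (Dataset K t × Fin K) × ℝ => l q.2 :=
        hlm.comp measurable_snd
      exact ((h2.mul h1).exp).ennreal_ofReal
  have hpair (t : ℕ) : AEMeasurable (fun p : Ω × ℝ => (if x t p.1 = k then (1 : ℝ≥0∞) else 0) *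
      ((if pulls (dataset x φ t p.1) k = n then 1 else 0) *
        ENNReal.ofReal (Real.exp (l p.2 * noise m (dataset x φ t p.1) k))))
      (Pr.prod (gaussianReal 0 1)) :=
    (hmeas t).comp_aemeasurable
      (((h.decision t).aemeasurable.comp_fst).prodMk measurable_snd.aemeasurable)
  have hswap (t : ℕ) : ∫⁻ ω, (if x t ω = k then 1 else 0) *
        ((if pulls (dataset x φ t ω) k = n then 1 else 0) *
          ENNReal.ofReal (Real.exp (noise m (dataset x φ t ω) k ^ 2 / (2 * σ ^ 2 * n)))) ∂Pr =
      ∫⁻ g, ENNReal.ofReal (Real.exp (l g ^ 2 / 2 * n)) * ∫⁻ ω, (if x t ω = k then 1 else 0) *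
        ((if pulls (dataset x φ t ω) k = n then 1 else 0) *
          expNoise (l g) m (dataset x φ t ω) k) ∂Pr ∂gaussianReal 0 1 := by
    calc _ = ∫⁻ ω, ∫⁻ g, (if x t ω = k then 1 else 0) *
          ((if pulls (dataset x φ t ω) k = n then 1 else 0) *
            ENNReal.ofReal (Real.exp (l g * noise m (dataset x φ t ω) k)))
          ∂gaussianReal 0 1 ∂Pr := by
          refine lintegral_congr fun ω => ?_
          rw [lintegral_const_mul _ (by fun_prop), lintegral_const_mul _ (by fun_prop),
            ofReal_exp_sq_div_eq_lintegral]
      _ = ∫⁻ g, ∫⁻ ω, (if x t ω = k then 1 else 0) *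
          ((if pulls (dataset x φ t ω) k = n then 1 else 0) *
            ENNReal.ofReal (Real.exp (l g * noise m (dataset x φ t ω) k)))
          ∂Pr ∂gaussianReal 0 1 := by
          exact lintegral_lintegral_swap (hpair t)
      _ = _ := by
          refine lintegral_congr fun g => ?_
          simp only [hexp]
          refine lintegral_const_mul' _ _ ENNReal.ofReal_ne_top
  simp only [hswap]
  calc _ ≤ ∫⁻ g, ∑ t ∈ Finset.range T, ENNReal.ofReal (Real.exp (l g ^ 2 / 2 * n)) *
          ∫⁻ ω, (if x t ω = k then 1 else 0) *
          ((if pulls (dataset x φ t ω) k = n then 1 else 0) *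
            expNoise (l g) m (dataset x φ t ω) k) ∂Pr ∂gaussianReal 0 1 := by
        refine le_of_eq (lintegral_finsetSum' _ fun t _ => ?_).symm
        refine AEMeasurable.congr (hpair t).lintegral_prod_left' (ae_of_all _ fun g => ?_)
        simp only [hexp]
        exact lintegral_const_mul' _ _ ENNReal.ofReal_ne_top
    _ ≤ gaussMoment σ := by
        refine lintegral_mono fun g => ?_
        rw [← Finset.mul_sum]
        refine (mul_le_of_le_one_right' (h.sum_lintegral_expNoise_le_one hP hm (l g) n T)).trans
          (ENNReal.ofReal_le_ofReal (Real.exp_le_exp.2 ?_))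
        rcases n.eq_zero_or_pos with h0 | h0
        · simp only [h0, Nat.cast_zero, mul_zero]
          positivity
        · have : (0 : ℝ) < n := by exact_mod_cast h0
          simp only [hl]
          rw [div_pow, mul_pow, Real.sq_sqrt this.le]
          refine le_of_eq ?_
          field_simp

end Run

/-! ### The expected number of pulls -/

@[fun_prop]
lemma measurable_weight {K t : ℕ} (σ c m : ℝ) (k : Fin K) :
    Measurable fun D : Dataset K t => weight σ c m D k := by
  unfold weight
  fun_prop

lemma measurable_ite_pulls {K t : ℕ} (k : Fin K) (p : ℕ → Prop) [DecidablePred p] :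
    Measurable fun D : Dataset K t => if p (pulls D k) then (1 : ℝ≥0∞) else 0 :=
  (measurable_of_countable fun n => if p n then (1 : ℝ≥0∞) else 0).comp (measurable_pulls k)

lemma sum_exp_neg_mul_le {c : ℝ} (hc : 0 < c) (T : ℕ) :
    ∑ n ∈ Finset.range T, Real.exp (-c * n) ≤ 1 + 1 / c := by
  have h1 : Real.exp (-c) < 1 := by rw [Real.exp_lt_one_iff]; linarith
  have h2 : ∀ n : ℕ, Real.exp (-c * n) = Real.exp (-c) ^ n := fun n => by
    rw [← Real.exp_nat_mul, mul_comm]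
  simp only [h2]
  rw [geom_sum_eq h1.ne, ← neg_div_neg_eq, neg_sub, neg_sub]
  have h3 : Real.exp (-c) * (1 + c) ≤ 1 := by
    have := Real.add_one_le_exp c
    calc Real.exp (-c) * (1 + c) ≤ Real.exp (-c) * Real.exp c := by gcongr; linarith
      _ = 1 := by rw [← Real.exp_add]; simp
  have h4 : 0 ≤ Real.exp (-c) ^ T := by positivity
  rw [div_le_iff₀ (by linarith)]
  have h5 : (1 + 1 / c) * (1 - Real.exp (-c)) = 1 + (1 - Real.exp (-c) * (1 + c)) / c := by
    field_simp
    ring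
  rw [h5]
  have : 0 ≤ (1 - Real.exp (-c) * (1 + c)) / c := div_nonneg (by linarith) hc.le
  linarith

section Run

variable {K : ℕ} {Ω : Type*} [MeasurableSpace Ω] {Pr : Measure Ω} [IsProbabilityMeasure Pr]
  {σ : ℝ} {P : Fin K → Measure ℝ} {x : ℕ → Ω → Fin K} {φ : ℕ → Ω → ℝ}

lemma IsRun.sum_lintegral_weight_le (hP : ∀ j, IsProbabilityMeasure (P j))
    {Q₀ : Fin K → ℝ} (h : IsRun Pr σ Q₀ P x φ) {k : Fin K} {m : ℝ}
    (hm : HasSubgaussianMGF (fun y : ℝ => y - m) 1 (P k)) {c : ℝ} (hc : 0 < c) (T : ℕ) :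
    ∑ t ∈ Finset.range T, ∫⁻ ω, (if x t ω = k then 1 else 0) *
        ENNReal.ofReal (weight σ c m (dataset x φ t ω) k) ∂Pr ≤
      gaussMoment σ * ENNReal.ofReal (1 + 1 / c) := by
  have hmeas (t n : ℕ) : Measurable fun D : Dataset K t =>
      (if pulls D k = n then (1 : ℝ≥0∞) else 0) *
        ENNReal.ofReal (Real.exp (noise m D k ^ 2 / (2 * σ ^ 2 * n))) :=
    (measurable_ite_pulls k (· = n)).mul (by fun_prop)
  have hsplit (t : ℕ) (ht : t ∈ Finset.range T) (ω : Ω) : (if x t ω = k then 1 else 0) *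
        ENNReal.ofReal (weight σ c m (dataset x φ t ω) k) =
      ∑ n ∈ Finset.range T, ENNReal.ofReal (Real.exp (-c * n)) * ((if x t ω = k then 1 else 0) *
        ((if pulls (dataset x φ t ω) k = n then 1 else 0) *
          ENNReal.ofReal (Real.exp (noise m (dataset x φ t ω) k ^ 2 / (2 * σ ^ 2 * n))))) := by
    rw [Finset.sum_eq_single_of_mem (pulls (dataset x φ t ω) k)
      (Finset.mem_range.2 ((pulls_le _ k).trans_lt (Finset.mem_range.1 ht)))]
    · rw [if_pos rfl, one_mul, weight, ENNReal.ofReal_mul (Real.exp_pos _).le, mul_left_comm]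
    · intro n _ hn
      simp [hn.symm]
  calc _ = ∑ t ∈ Finset.range T, ∑ n ∈ Finset.range T, ENNReal.ofReal (Real.exp (-c * n)) *
        ∫⁻ ω, (if x t ω = k then 1 else 0) *
          ((if pulls (dataset x φ t ω) k = n then 1 else 0) * ENNReal.ofReal
            (Real.exp (noise m (dataset x φ t ω) k ^ 2 / (2 * σ ^ 2 * n)))) ∂Pr := by
        refine Finset.sum_congr rfl fun t ht => ?_
        simp only [hsplit t ht]
        rw [lintegral_finsetSum' _ fun n _ => (h.aemeasurable_ite t k (hmeas t n)).const_mul _]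
        exact Finset.sum_congr rfl fun n _ => lintegral_const_mul' _ _ ENNReal.ofReal_ne_top
    _ ≤ ∑ n ∈ Finset.range T, ENNReal.ofReal (Real.exp (-c * n)) * gaussMoment σ := by
        rw [Finset.sum_comm]
        refine Finset.sum_le_sum fun n _ => ?_
        rw [← Finset.mul_sum]
        gcongr
        exact h.sum_lintegral_exp_sq_le hP hm n T
    _ ≤ _ := by
        rw [← Finset.sum_mul, mul_comm, ← ENNReal.ofReal_sum_of_nonneg fun n _ => by positivity]
        gcongr
        exact sum_exp_neg_mul_le hc T

/-- An arm is pulled at most `b + 1` times while its number of earlier pulls is at most `b`. -/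
lemma IsRun.sum_lintegral_ite_pulls_le (hP : ∀ j, IsProbabilityMeasure (P j))
    {Q₀ : Fin K → ℝ} (h : IsRun Pr σ Q₀ P x φ) {k : Fin K} {m : ℝ}
    (hm : HasSubgaussianMGF (fun y : ℝ => y - m) 1 (P k)) {b : ℝ} (hb : 0 ≤ b) (T : ℕ) :
    ∑ t ∈ Finset.range T, ∫⁻ ω, (if x t ω = k then 1 else 0) *
        (if (pulls (dataset x φ t ω) k : ℝ) ≤ b then 1 else 0) ∂Pr ≤
      ENNReal.ofReal (b + 1) := by
  have hsplit (t : ℕ) (ω : Ω) : (if x t ω = k then (1 : ℝ≥0∞) else 0) *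
        (if (pulls (dataset x φ t ω) k : ℝ) ≤ b then 1 else 0) =
      ∑ n ∈ Finset.range (⌊b⌋₊ + 1), (if x t ω = k then 1 else 0) *
        ((if pulls (dataset x φ t ω) k = n then 1 else 0) *
          expNoise 0 m (dataset x φ t ω) k) := by
    rw [← Finset.mul_sum]
    simp [expNoise, Nat.le_floor_iff hb]
  have hmeas (t n : ℕ) : Measurable fun D : Dataset K t =>
      (if pulls D k = n then (1 : ℝ≥0∞) else 0) * expNoise 0 m D k :=
    (measurable_ite_pulls k (· = n)).mul (by fun_prop)
  simp only [hsplit]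
  calc _ = ∑ n ∈ Finset.range (⌊b⌋₊ + 1), ∑ t ∈ Finset.range T,
        ∫⁻ ω, (if x t ω = k then 1 else 0) *
          ((if pulls (dataset x φ t ω) k = n then 1 else 0) *
            expNoise 0 m (dataset x φ t ω) k) ∂Pr := by
        rw [Finset.sum_comm]
        exact Finset.sum_congr rfl fun t _ =>
          lintegral_finsetSum' _ fun n _ => h.aemeasurable_ite t k (hmeas t n)
    _ ≤ ∑ n ∈ Finset.range (⌊b⌋₊ + 1), 1 :=
        Finset.sum_le_sum fun n _ => h.sum_lintegral_expNoise_le_one hP hm 0 n T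
    _ = ((⌊b⌋₊ + 1 : ℕ) : ℝ≥0∞) := by simp
    _ ≤ _ := by
        rw [← ENNReal.ofReal_natCast]
        refine ENNReal.ofReal_le_ofReal ?_
        push_cast
        have := Nat.floor_le hb
        linarith

/-- The expected number of pulls of arm `j`, when arm `k` is better by `Δ`; the threshold `b` on the
number of pulls is free. -/
lemma IsRun.sum_lintegral_decision_le (hσ : 0 < σ) (hP : ∀ j, IsProbabilityMeasure (P j))
    (h : IsRun Pr σ (uniformPrior K) P x φ) {j k : Fin K} {m Δ c : ℝ} (hΔ : 0 < Δ)
    (hc : c = Δ ^ 2 / (32 * σ ^ 2))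
    (hj : HasSubgaussianMGF (fun y : ℝ => y - m) 1 (P j))
    (hk : HasSubgaussianMGF (fun y : ℝ => y - (m + Δ)) 1 (P k)) {b : ℝ} (hb : 0 ≤ b) (T : ℕ) :
    ∑ t ∈ Finset.range T, ∫⁻ ω, (if x t ω = j then 1 else 0) ∂Pr ≤
      ENNReal.ofReal (b + 1) + gaussMoment σ * ENNReal.ofReal (1 + 1 / c) +
        T * ENNReal.ofReal (Real.exp (-c * b)) + gaussMoment σ * ENNReal.ofReal (1 + 1 / c) := by
  have hc0 : 0 < c := by rw [hc]; positivity
  have hstep (t : ℕ) : ∫⁻ ω, (if x t ω = j then (1 : ℝ≥0∞) else 0) ∂Pr ≤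
      ∫⁻ ω, (if x t ω = j then 1 else 0) *
        (if (pulls (dataset x φ t ω) j : ℝ) ≤ b then 1 else 0) ∂Pr +
      ∫⁻ ω, (if x t ω = j then 1 else 0) *
        ENNReal.ofReal (weight σ c m (dataset x φ t ω) j) ∂Pr +
      ENNReal.ofReal (Real.exp (-c * b)) +
      ∫⁻ ω, (if x t ω = k then 1 else 0) *
        ENNReal.ofReal (weight σ c (m + Δ) (dataset x φ t ω) k) ∂Pr := by
    have hf1 : Measurable fun D : Dataset K t =>
        if (pulls D j : ℝ) ≤ b then (1 : ℝ≥0∞) else 0 :=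
      measurable_ite_pulls j fun n => (n : ℝ) ≤ b
    have hf2 : Measurable fun D : Dataset K t => ENNReal.ofReal (weight σ c m D j) := by fun_prop
    have hf3 : Measurable fun D : Dataset K t => ENNReal.ofReal (weight σ c (m + Δ) D k) := by
      fun_prop
    have hA (i : Fin K) {f : Dataset K t → ℝ≥0∞} (hf : Measurable f) :
        AEMeasurable (fun ω => ENNReal.ofReal
          (posterior σ (uniformPrior K) (dataset x φ t ω) i) * f (dataset x φ t ω)) Pr :=
      ((measurable_posterior σ _ i).ennreal_ofReal.mul hf).comp_aemeasurable
        (h.aemeasurable_dataset t)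
    have h0 := h.lintegral_decision hσ t j (f := fun _ => 1) measurable_const
    simp only [mul_one] at h0
    rw [h0, h.lintegral_decision hσ t j hf1, h.lintegral_decision hσ t j hf2,
      h.lintegral_decision hσ t k hf3]
    have hconst : ENNReal.ofReal (Real.exp (-c * b)) =
        ∫⁻ _, ENNReal.ofReal (Real.exp (-c * b)) ∂Pr := by simp
    rw [hconst, ← lintegral_add_left' (hA j hf1), ← lintegral_add_right' _ aemeasurable_const,
      ← lintegral_add_right' _ (hA k hf3)]
    refine lintegral_mono fun ω => ?_
    set D := dataset x φ t ω
    have hpj := posterior_uniformPrior_nonneg hσ D j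
    have hpk := posterior_uniformPrior_nonneg hσ D k
    have hwj := weight_nonneg σ c m D j
    have hwk := weight_nonneg σ c (m + Δ) D k
    have hif : (if (pulls D j : ℝ) ≤ b then (1 : ℝ≥0∞) else 0) =
        ENNReal.ofReal (if (pulls D j : ℝ) ≤ b then 1 else 0) := by split_ifs <;> simp
    have hif0 : (0 : ℝ) ≤ if (pulls D j : ℝ) ≤ b then 1 else 0 := by split_ifs <;> simp
    rw [hif, ← ENNReal.ofReal_mul hpj, ← ENNReal.ofReal_mul hpj, ← ENNReal.ofReal_mul hpk,
      ← ENNReal.ofReal_add (by positivity) (by positivity),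
      ← ENNReal.ofReal_add (by positivity) (by positivity),
      ← ENNReal.ofReal_add (by positivity) (by positivity)]
    exact ENNReal.ofReal_le_ofReal (posterior_le_of_pulls hσ hΔ.le hc b D j k)
  refine (Finset.sum_le_sum fun t _ => hstep t).trans ?_
  simp only [Finset.sum_add_distrib]
  gcongr
  · exact h.sum_lintegral_ite_pulls_le hP hj hb T
  · exact h.sum_lintegral_weight_le hP hj hc0 T
  · simp
  · exact h.sum_lintegral_weight_le hP hk hc0 T

end Run

/-! ### The regret -/

lemma mean_le_iSup_mean {K : ℕ} (P : Fin K → Measure ℝ) (j : Fin K) :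
    mean P j ≤ ⨆ k, mean P k := le_ciSup (Set.finite_range _).bddAbove j

lemma gap_nonneg {K : ℕ} (P : Fin K → Measure ℝ) (j : Fin K) : 0 ≤ gap P j :=
  sub_nonneg.2 (mean_le_iSup_mean P j)

/-- The factor, depending on `σ` only, in the bound on the regret due to a single arm. -/
def regretConst (σ : ℝ) : ℝ :=
  1 + 32 * σ ^ 2 + 2 * (gaussMoment σ).toReal + 64 * (gaussMoment σ).toReal * σ ^ 2

lemma one_le_regretConst (σ : ℝ) : 1 ≤ regretConst σ := by
  unfold regretConst
  have : 0 ≤ (gaussMoment σ).toReal := ENNReal.toReal_nonneg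
  have : 0 ≤ 32 * σ ^ 2 + 2 * (gaussMoment σ).toReal + 64 * (gaussMoment σ).toReal * σ ^ 2 := by
    positivity
  linarith

/-- The gap-dependent bound is of order `log T / Δ + Δ`, because `log⁺ (T Δ²) ≤ log T + Δ²` and
`log T` is bounded below. -/
lemma one_add_posLog_div_le {T Δ : ℝ} (hT : 2 ≤ T) (hΔ : 0 < Δ) :
    (1 + max 0 (Real.log (T * Δ ^ 2))) / Δ ≤ 3 * (Real.log T / Δ) + Δ := by
  have h1 : 1 / 2 ≤ Real.log T := by
    have := Real.log_two_gt_d9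
    have := Real.log_le_log (by norm_num) hT
    linarith
  have h2 : Real.log (T * Δ ^ 2) ≤ Real.log T + Δ ^ 2 := by
    rw [Real.log_mul (by positivity) (by positivity)]
    have := Real.log_le_sub_one_of_pos (show 0 < Δ ^ 2 by positivity)
    linarith
  have h3 : max 0 (Real.log (T * Δ ^ 2)) ≤ Real.log T + Δ ^ 2 :=
    max_le (by positivity) h2
  rw [div_le_iff₀ hΔ, add_mul, mul_assoc, div_mul_cancel₀ _ hΔ.ne']
  nlinarith

/-- For `Δ` above the scale `a` at which `T a² = K L`, `L = log K`, the gap-dependent bound is of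
order `L / a`. -/
lemma one_add_posLog_div_le_of_le {K T Δ a : ℝ} (hK : 2 ≤ K) (ha : 0 < a)
    (haT : T * a ^ 2 = K * Real.log K) (hΔ : a ≤ Δ) :
    (1 + max 0 (Real.log (T * Δ ^ 2))) / Δ ≤ 8 * Real.log K / a := by
  set L := Real.log K with hL
  have h1 : 1 / 2 ≤ L := by
    have := Real.log_two_gt_d9
    have := Real.log_le_log (by norm_num) hK
    linarith
  have hΔ0 : 0 < Δ := ha.trans_le hΔ
  set u := Δ / a with hu
  have hu1 : 1 ≤ u := (one_le_div ha).2 hΔ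
  have hΔu : Δ = u * a := by rw [hu]; field_simp
  have h2 : Real.log (T * Δ ^ 2) ≤ 2 * u + 2 * L := by
    have : T * Δ ^ 2 = u ^ 2 * (K * L) := by rw [hΔu, ← haT]; ring
    rw [this, Real.log_mul (by positivity) (by positivity),
      Real.log_mul (by positivity) (by positivity), Real.log_pow]
    have h3 := Real.log_le_sub_one_of_pos (show 0 < u by positivity)
    have h4 := Real.log_le_sub_one_of_pos (show 0 < L by positivity)
    push_cast
    linarith
  have h3 : max 0 (Real.log (T * Δ ^ 2)) ≤ 2 * u + 2 * L := max_le (by positivity) h2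
  have h4 : 8 * L / a * Δ = 8 * L * u := by rw [hu]; ring
  rw [div_le_iff₀ hΔ0, h4]
  nlinarith [mul_nonneg (sub_nonneg.2 h1) (sub_nonneg.2 hu1)]

section Run

variable {K : ℕ} {Ω : Type*} [MeasurableSpace Ω] {Pr : Measure Ω} [IsProbabilityMeasure Pr]
  {σ : ℝ} {P : Fin K → Measure ℝ} {x : ℕ → Ω → Fin K} {φ : ℕ → Ω → ℝ}

/-- The expected number of pulls of arm `j` in the first `T` rounds. -/
def expectedPulls (Pr : Measure Ω) (x : ℕ → Ω → Fin K) (j : Fin K) (T : ℕ) : ℝ :=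
  ∑ t ∈ Finset.range T, ∫ ω, (if x t ω = j then 1 else 0) ∂Pr

lemma expectedPulls_nonneg (Pr : Measure Ω) (x : ℕ → Ω → Fin K) (j : Fin K) (T : ℕ) :
    0 ≤ expectedPulls Pr x j T :=
  Finset.sum_nonneg fun _ _ => integral_nonneg fun _ => by dsimp only; split_ifs <;> simp

lemma IsRun.integrable_ite {Q₀ : Fin K → ℝ} (h : IsRun Pr σ Q₀ P x φ) (t : ℕ) (j : Fin K) :
    Integrable (fun ω => if x t ω = j then (1 : ℝ) else 0) Pr := by
  refine Integrable.of_bound (C := 1) ((measurable_of_countable fun a : Fin K =>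
    if a = j then (1 : ℝ) else 0).comp_aemeasurable
      (h.aemeasurable_decision t)).aestronglyMeasurable (ae_of_all _ fun ω => ?_)
  split_ifs <;> simp

lemma IsRun.sum_expectedPulls {Q₀ : Fin K → ℝ} (h : IsRun Pr σ Q₀ P x φ) (T : ℕ) :
    ∑ j, expectedPulls Pr x j T = T := by
  unfold expectedPulls
  rw [Finset.sum_comm]
  simp_rw [← integral_finsetSum Finset.univ fun j _ => h.integrable_ite _ j]
  simp

lemma IsRun.integral_regret {Q₀ : Fin K → ℝ} (h : IsRun Pr σ Q₀ P x φ) (T : ℕ) :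
    ∫ ω, regret P (fun t => x t ω) T ∂Pr = ∑ j, gap P j * expectedPulls Pr x j T := by
  have hreg (ω : Ω) : regret P (fun t => x t ω) T =
      ∑ t ∈ Finset.range T, ∑ j, gap P j * if x t ω = j then 1 else 0 := by
    simp [regret, gap]
  simp_rw [hreg, expectedPulls, Finset.mul_sum]
  rw [integral_finsetSum _ fun t _ =>
    integrable_finsetSum _ fun j _ => (h.integrable_ite t j).const_mul _, Finset.sum_comm]
  refine Finset.sum_congr rfl fun t _ => ?_
  rw [integral_finsetSum _ fun j _ => (h.integrable_ite t j).const_mul _]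
  simp_rw [integral_const_mul]

lemma IsRun.expectedPulls_le {Q₀ : Fin K → ℝ} (h : IsRun Pr σ Q₀ P x φ) (j : Fin K) (T : ℕ) :
    expectedPulls Pr x j T ≤ T := by
  rw [← h.sum_expectedPulls T]
  exact Finset.single_le_sum (f := fun j => expectedPulls Pr x j T)
    (fun i _ => expectedPulls_nonneg Pr x i T) (Finset.mem_univ j)

/-- The threshold in `IsRun.sum_lintegral_decision_le` is chosen to make `exp (-c b)` at most
`1 / (T Δ²)`. -/
lemma IsRun.gap_mul_expectedPulls_le (hσ : 1 < σ) (hP : ∀ j, IsProbabilityMeasure (P j))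
    (hsub : ∀ j, HasSubgaussianMGF (fun y : ℝ => y - mean P j) 1 (P j))
    (h : IsRun Pr σ (uniformPrior K) P x φ) {j : Fin K} (hj : 0 < gap P j) {T : ℕ}
    (hT : 1 ≤ T) :
    gap P j * expectedPulls Pr x j T ≤ regretConst σ *
      (gap P j + (1 + max 0 (Real.log (T * gap P j ^ 2))) / gap P j) := by
  have : Nonempty (Fin K) := ⟨j⟩
  obtain ⟨k, hk⟩ := exists_eq_ciSup_of_finite (f := mean P)
  set Δ := gap P j with hΔ
  have hkΔ : mean P k = mean P j + Δ := by rw [hk, hΔ, gap]; ring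
  set ℓ := max 0 (Real.log (T * Δ ^ 2)) with hℓ
  have hℓ0 : 0 ≤ ℓ := le_max_left _ _
  have hσ0 : 0 < σ := by linarith
  obtain ⟨c, hc⟩ : ∃ c, c = Δ ^ 2 / (32 * σ ^ 2) := ⟨_, rfl⟩
  have hc0 : 0 < c := by rw [hc]; positivity
  have hk' := hsub k
  rw [hkΔ] at hk'
  set M := (gaussMoment σ).toReal with hM
  have hM' : gaussMoment σ = ENNReal.ofReal M :=
    (ENNReal.ofReal_toReal (gaussMoment_lt_top hσ).ne).symm
  have hM0 : 0 ≤ M := ENNReal.toReal_nonneg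
  have hT0 : (0 : ℝ) < T := by exact_mod_cast hT
  have hpull : expectedPulls Pr x j T ≤
      (ℓ / c + 1) + M * (1 + 1 / c) + T * Real.exp (-c * (ℓ / c)) + M * (1 + 1 / c) := by
    have hmain := h.sum_lintegral_decision_le hσ0 hP hj hc (hsub j) hk'
      (b := ℓ / c) (by positivity) T
    have hlhs : ENNReal.ofReal (expectedPulls Pr x j T) =
        ∑ t ∈ Finset.range T, ∫⁻ ω, (if x t ω = j then 1 else 0) ∂Pr := by
      rw [expectedPulls, ENNReal.ofReal_sum_of_nonneg fun _ _ => integral_nonneg fun _ => by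
        dsimp only; split_ifs <;> simp]
      refine Finset.sum_congr rfl fun t _ => ?_
      rw [ofReal_integral_eq_lintegral_ofReal (h.integrable_ite t j)
        (ae_of_all _ fun _ => by dsimp only; split_ifs <;> simp)]
      refine lintegral_congr fun ω => ?_
      split_ifs <;> simp
    rw [← hlhs, hM', ← ENNReal.ofReal_natCast, ← ENNReal.ofReal_mul hM0,
      ← ENNReal.ofReal_mul hT0.le,
      ← ENNReal.ofReal_add (by positivity) (by positivity),
      ← ENNReal.ofReal_add (by positivity) (by positivity),
      ← ENNReal.ofReal_add (by positivity) (by positivity)] at hmain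
    exact (ENNReal.ofReal_le_ofReal_iff (by positivity)).1 hmain
  have hexp : T * Real.exp (-c * (ℓ / c)) ≤ 1 / Δ ^ 2 := by
    have h1 : -c * (ℓ / c) = -ℓ := by field_simp
    have h2 : Real.exp (-ℓ) ≤ (T * Δ ^ 2)⁻¹ := by
      rw [Real.exp_neg]
      refine inv_anti₀ (by positivity) ?_
      rw [← Real.exp_log (show 0 < T * Δ ^ 2 by positivity)]
      exact Real.exp_le_exp.2 (le_max_right _ _)
    rw [h1]
    calc T * Real.exp (-ℓ) ≤ T * (T * Δ ^ 2)⁻¹ := by gcongr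
      _ = 1 / Δ ^ 2 := by field_simp
  have hsum : expectedPulls Pr x j T ≤
      1 + 2 * M + (32 * σ ^ 2 * ℓ + 64 * M * σ ^ 2 + 1) / Δ ^ 2 := by
    refine (hpull.trans (add_le_add_left (add_le_add_right hexp _) _)).trans_eq ?_
    rw [hc]
    field_simp
    ring
  calc Δ * expectedPulls Pr x j T
      ≤ Δ * (1 + 2 * M + (32 * σ ^ 2 * ℓ + 64 * M * σ ^ 2 + 1) / Δ ^ 2) := by gcongr
    _ = (1 + 2 * M) * Δ + (32 * σ ^ 2 * ℓ + (1 + 64 * M * σ ^ 2)) / Δ := by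
        field_simp
        ring
    _ ≤ regretConst σ * Δ + (regretConst σ * ℓ + regretConst σ) / Δ := by
        unfold regretConst
        rw [← hM]
        have : 0 ≤ M * σ ^ 2 := by positivity
        gcongr ?_ * Δ + (?_ * ℓ + ?_) / Δ <;> nlinarith
    _ = _ := by ring

lemma IsRun.integral_regret_le_log (hσ : 1 < σ) (hP : ∀ j, IsProbabilityMeasure (P j))
    (hsub : ∀ j, HasSubgaussianMGF (fun y : ℝ => y - mean P j) 1 (P j))
    (h : IsRun Pr σ (uniformPrior K) P x φ) {T : ℕ} (hT : 1 ≤ T) :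
    ∫ ω, regret P (fun t => x t ω) T ∂Pr ≤ 9 * regretConst σ *
      (∑ j with 0 < gap P j, Real.log T / gap P j + ∑ j, gap P j) := by
  have hB := one_le_regretConst σ
  have hlog : 0 ≤ Real.log T := Real.log_natCast_nonneg T
  have hS : 0 ≤ ∑ j with 0 < gap P j, Real.log T / gap P j :=
    Finset.sum_nonneg fun j _ => div_nonneg hlog (gap_nonneg P j)
  have hG : 0 ≤ ∑ j, gap P j := Finset.sum_nonneg fun j _ => gap_nonneg P j
  rw [h.integral_regret]
  have hone (j : Fin K) : gap P j * expectedPulls Pr x j T ≤ regretConst σ *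
      (3 * (if 0 < gap P j then Real.log T / gap P j else 0) + 2 * gap P j) := by
    rcases (gap_nonneg P j).eq_or_lt with h0 | h0
    · simp [← h0]
    rw [if_pos h0]
    have hdiv : 0 ≤ Real.log T / gap P j := div_nonneg hlog h0.le
    -- For `T = 1` the logarithm vanishes, but a single pull costs at most the gap.
    rcases hT.eq_or_lt with rfl | hT2
    · have := h.expectedPulls_le j 1
      push_cast at this
      nlinarith
    · refine (h.gap_mul_expectedPulls_le hσ hP hsub h0 hT).trans ?_
      have := one_add_posLog_div_le (T := T) (by exact_mod_cast hT2) h0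
      exact mul_le_mul_of_nonneg_left (by linarith) (by linarith)
  refine (Finset.sum_le_sum fun j _ => hone j).trans ?_
  rw [← Finset.mul_sum, Finset.sum_add_distrib, ← Finset.mul_sum, ← Finset.mul_sum,
    ← Finset.sum_filter]
  nlinarith [mul_nonneg (by linarith : 0 ≤ regretConst σ) hS,
    mul_nonneg (by linarith : 0 ≤ regretConst σ) hG]

/-- Arms with gap below `a = √(K T log K) / T` cost at most `a T` together, as there are `T` pulls
in all; each of the others costs `O(Δ + log K / a)`. -/
lemma IsRun.integral_regret_le_sqrt (hσ : 1 < σ) (hP : ∀ j, IsProbabilityMeasure (P j))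
    (hsub : ∀ j, HasSubgaussianMGF (fun y : ℝ => y - mean P j) 1 (P j))
    (h : IsRun Pr σ (uniformPrior K) P x φ) (hK : 1 ≤ K) {T : ℕ} (hT : 1 ≤ T) :
    ∫ ω, regret P (fun t => x t ω) T ∂Pr ≤ 9 * regretConst σ *
      (Real.sqrt (K * T * Real.log K) + ∑ j, gap P j) := by
  have hB := one_le_regretConst σ
  have hG : 0 ≤ ∑ j, gap P j := Finset.sum_nonneg fun j _ => gap_nonneg P j
  have hT0 : (0 : ℝ) < T := by exact_mod_cast hT
  rw [h.integral_regret]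
  rcases hK.eq_or_lt with rfl | hK2
  · have h0 (j : Fin 1) : gap P j = 0 := by
      rw [gap, ciSup_unique, Subsingleton.elim j default, sub_self]
    simp [h0]
  have hK2' : (2 : ℝ) ≤ K := by exact_mod_cast hK2
  have hL : 0 < Real.log K := Real.log_pos (by linarith)
  set R := Real.sqrt (K * T * Real.log K) with hR
  have hR0 : 0 < R := Real.sqrt_pos.2 (by positivity)
  have hR2 : R ^ 2 = K * T * Real.log K := Real.sq_sqrt (by positivity)
  have ha : 0 < R / T := by positivity
  have haT : T * (R / T) ^ 2 = K * Real.log K := by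
    rw [div_pow, hR2]
    field_simp
  have hone (j : Fin K) : gap P j * expectedPulls Pr x j T ≤
      R / T * expectedPulls Pr x j T + regretConst σ * gap P j +
        regretConst σ * (8 * Real.log K / (R / T)) := by
    have hN := expectedPulls_nonneg Pr x j T
    have hg := gap_nonneg P j
    have hterm : 0 ≤ regretConst σ * (8 * Real.log K / (R / T)) := by positivity
    rcases le_total (gap P j) (R / T) with hle | hle
    · have := mul_le_mul_of_nonneg_right hle hN
      have : 0 ≤ regretConst σ * gap P j := by positivity
      linarith
    · have h1 := h.gap_mul_expectedPulls_le hσ hP hsub (ha.trans_le hle) hT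
      have h2 := one_add_posLog_div_le_of_le hK2' ha haT hle
      have h3 := mul_le_mul_of_nonneg_left h2 (show 0 ≤ regretConst σ by linarith)
      have : 0 ≤ R / T * expectedPulls Pr x j T := by positivity
      linarith
  refine (Finset.sum_le_sum fun j _ => hone j).trans ?_
  rw [Finset.sum_add_distrib, Finset.sum_add_distrib, ← Finset.mul_sum, ← Finset.mul_sum,
    h.sum_expectedPulls, Finset.sum_const, Finset.card_univ, Fintype.card_fin, nsmul_eq_mul,
    div_mul_cancel₀ _ hT0.ne']
  have hKL : K * (regretConst σ * (8 * Real.log K / (R / T))) = 8 * regretConst σ * R := by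
    field_simp
    rw [hR2]
    ring
  rw [hKL]
  nlinarith [mul_nonneg (by linarith : 0 ≤ regretConst σ) hG]

end Run

end MINTS

end

theorem mainTheorem1 (σ : ℝ) (hσ : 1 < σ) :
    ∃ C : ℝ, 0 < C ∧
      ∀ (K : ℕ), 1 ≤ K →
      ∀ (P : Fin K → Measure ℝ), (∀ j, IsProbabilityMeasure (P j)) →
        (∀ j, HasSubgaussianMGF (fun y : ℝ => y - MINTS.mean P j) 1 (P j)) →
      ∀ (Ω : Type*) [MeasurableSpace Ω] (Pr : Measure Ω) [IsProbabilityMeasure Pr]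
        (x : ℕ → Ω → Fin K) (φ : ℕ → Ω → ℝ),
        MINTS.IsRun Pr σ (MINTS.uniformPrior K) P x φ →
      ∀ (T : ℕ), 1 ≤ T →
        ∫ ω, MINTS.regret P (fun t => x t ω) T ∂Pr ≤
          C * (min (∑ j with 0 < MINTS.gap P j, Real.log T / MINTS.gap P j)
                (Real.sqrt (K * T * Real.log K))
            + ∑ j, MINTS.gap P j) := by
  have hB := MINTS.one_le_regretConst σ
  refine ⟨9 * MINTS.regretConst σ, by linarith, ?_⟩
  intro K hK P hP hsub Ω _ Pr _ x φ h T hT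
  rcases min_choice (∑ j with 0 < MINTS.gap P j, Real.log T / MINTS.gap P j)
    (Real.sqrt (K * T * Real.log K)) with hmin | hmin <;> rw [hmin]
  · exact h.integral_regret_le_log hσ hP hsub hT
  · exact h.integral_regret_le_sqrt hσ hP hsub hK hT
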